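/- Let $\Gamma$ be a discrete group, let $\mathrm{Sub}(\Gamma)$ be its set of subgroups with the Chabauty topology (the topology induced by $X\mapsto \mathbb 1_X$ from the product topology on $\{0,1\}^\Gamma$), and let $C^*_r(\Gamma)$ be the reduced group $C^*$-algebra, i.e. the norm closure in $B(\ell^2(\Gamma))$ of the image of $\mathbb C[\Gamma]$ under the left regular representation; we regard $\mathbb C[\Gamma]$ as a subset of $C^*_r(\Gamma)$. If $\Gamma$ is amenable, then for every subgroup $X\subseteq\Gamma$ the quasi-regular representation $\lambda_{\Gamma/X}$ on $\ell^2(\Gamma/X)$, $\lambda_{\Gamma/X}(g)\delta_{hX}=\delta_{ghX}$, extends uniquely to a $*$-representation of $C^*_r(\Gamma)$, also denoted $\lambda_{\Gamma/X}$. For a set $\mathcal X\subseteq\mathrm{Sub}(\Gamma)$ that is closed and invariant under conjugation by elements of $\Gamma$, put $$J_{\Gamma,\mathcal X}=\bigcap_{X\in\mathcal X}\ker(\lambda_{\Gamma/X})\trianglelefteq C^*_r(\Gamma).$$ Let $\mathcal D_\Gamma$ be the set of all closed conjugation-invariant $\mathcal X\subseteq\mathrm{Sub}(\Gamma)$ for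 which $J_{\Gamma,\mathcal X}\cap\mathbb C[\Gamma]$ is dense in $J_{\Gamma,\mathcal X}$. An amenable discrete group $\Gamma$ has the Density Property if $\mathcal D_\Gamma$ contains all closed conjugation-invariant sets of subgroups of $\Gamma$. **Theorem.** Let $\Gamma$ be an amenable discrete group and $\mathcal X\subseteq\mathrm{Sub}(\Gamma)$ a closed and conjugation-invariant set of subgroups. If either (I) $\Gamma$ is countable and abelian, or (II) every $X\in\mathcal X$ is finite, then $\mathcal X\in\mathcal D_\Gamma$, that is, $J_{\Gamma,\mathcal X}\cap\mathbb C[\Gamma]$ is dense in $J_{\Gamma,\mathcal X}$. In particular, every countable abelian group is amenable and has the Density Property. -/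

import Mathlib

open scoped ENNReal

noncomputable section

namespace GroupDensity

universe u v

/-- A discrete group is amenable if it satisfies the Følner condition: for all finite `S ⊆ Γ` and
all `ε > 0` there is a non-empty finite `F ⊆ Γ` with `|gF ∆ F| ≤ ε |F|` for all `g ∈ S`.
The group need not be countable. -/
class IsAmenable (Γ : Type u) [Group Γ] : Prop where
  exists_folner : ∀ (S : Finset Γ) (ε : ℝ), 0 < ε → ∃ F : Finset Γ, F.Nonempty ∧
    ∀ g ∈ S, ((symmDiff ((fun x => g * x) '' (F : Set Γ)) (F : Set Γ)).ncard : ℝ) ≤ ε * F.card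

/-- The Chabauty topology on `Sub(Γ)` for a discrete group `Γ`: the topology induced by
`X ↦ 1_X` from the product topology on `{0,1}^Γ`. -/
instance chabautyTopology (Γ : Type u) [Group Γ] : TopologicalSpace (Subgroup Γ) :=
  open scoped Classical in
  TopologicalSpace.induced (fun (X : Subgroup Γ) (g : Γ) => decide (g ∈ X))
    (inferInstance : TopologicalSpace (Γ → Bool))

/-- A set of subgroups is conjugation-invariant if `gXg⁻¹ ∈ 𝒳` for all `X ∈ 𝒳` and `g ∈ Γ`. -/
def ConjInvariant {Γ : Type u} [Group Γ] (𝒳 : Set (Subgroup Γ)) : Prop :=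
  ∀ X ∈ 𝒳, ∀ g : Γ, X.map (MulAut.conj g).toMonoidHom ∈ 𝒳

/-- The Hilbert space `ℓ²(S)`. -/
abbrev Ell2 (S : Type v) : Type v := lp (fun _ : S => ℂ) 2

section perm

variable {Γ : Type u} [Group Γ] {S : Type v} [MulAction Γ S]

lemma memℓp_comp {T : Type*} (e : T ≃ S) (ξ : Ell2 S) :
    Memℓp (fun s : T => (ξ (e s) : ℂ)) 2 := by
  have h := (lp.memℓp ξ).summable (by norm_num)
  exact memℓp_gen (h.comp_injective e.injective)

lemma summable_sq (ξ : Ell2 S) : Summable fun s => ‖ξ s‖ ^ 2 := by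
  have h := (lp.memℓp ξ).summable (by norm_num)
  simpa using h

lemma norm_sq_eq (ξ : Ell2 S) : ‖ξ‖ ^ 2 = ∑' s, ‖ξ s‖ ^ 2 := by
  have h := lp.norm_rpow_eq_tsum (p := 2) (by norm_num) ξ
  simpa using h

variable (S) in
/-- The unitary `ξ ↦ (s ↦ ξ (g⁻¹ s))` of `ℓ²(S)`; it sends `δ_s` to `δ_{gs}`. -/
def permIsometry (g : Γ) : Ell2 S →ₗᵢ[ℂ] Ell2 S where
  toFun ξ := ⟨fun s => ξ (g⁻¹ • s), memℓp_comp (MulAction.toPerm g⁻¹) ξ⟩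
  map_add' ξ η := by ext s; rfl
  map_smul' c ξ := by ext s; simp
  norm_map' ξ := by
    have h : ∀ x y : ℝ, 0 ≤ x → 0 ≤ y → x ^ 2 = y ^ 2 → x = y := fun x y hx hy hxy =>
      (sq_eq_sq₀ hx hy).1 hxy
    refine h _ _ (norm_nonneg _) (norm_nonneg _) ?_
    rw [norm_sq_eq, norm_sq_eq]
    exact (MulAction.toPerm g⁻¹ : Equiv.Perm S).tsum_eq (fun s => ‖ξ s‖ ^ 2)

variable (Γ S) in
/-- The permutation representation of `Γ` on `ℓ²(S)` for a `Γ`-set `S`. -/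
def permRep : Γ →* (Ell2 S →L[ℂ] Ell2 S) where
  toFun g := (permIsometry S g).toContinuousLinearMap
  map_one' := by ext ξ s; simp [permIsometry]
  map_mul' g h := by ext ξ s; simp [permIsometry, mul_smul]

@[simp] lemma permRep_apply (g : Γ) (ξ : Ell2 S) (s : S) : permRep Γ S g ξ s = ξ (g⁻¹ • s) := rfl

open scoped Classical in
/-- `λ(g) δ_s = δ_{gs}`. -/
lemma permRep_single (g : Γ) (s : S) :
    permRep Γ S g (lp.single 2 s (1 : ℂ)) = lp.single 2 (g • s) (1 : ℂ) := by
  ext t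
  simp [lp.single_apply, Pi.single_apply, inv_smul_eq_iff]

lemma star_permRep (g : Γ) : star (permRep Γ S g) = permRep Γ S g⁻¹ := by
  rw [ContinuousLinearMap.star_eq_adjoint, eq_comm, ContinuousLinearMap.eq_adjoint_iff]
  intro ξ η
  rw [lp.inner_eq_tsum, lp.inner_eq_tsum]
  rw [← (MulAction.toPerm g : Equiv.Perm S).tsum_eq (fun s => inner ℂ (ξ s) (permRep Γ S g η s))]
  simp

variable (Γ S) in
/-- The permutation representation on `ℓ²(S)`, extended linearly to the group algebra `ℂ[Γ]`. -/
def permAlg : MonoidAlgebra ℂ Γ →ₐ[ℂ] (Ell2 S →L[ℂ] Ell2 S) :=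
  MonoidAlgebra.lift ℂ _ Γ (permRep Γ S)

lemma permAlg_eq_sum (f : MonoidAlgebra ℂ Γ) :
    permAlg Γ S f = ∑ g ∈ f.coeff.support, f.coeff g • permRep Γ S g := by
  rw [permAlg, MonoidAlgebra.lift_apply, Finsupp.sum]

lemma permAlg_apply (f : MonoidAlgebra ℂ Γ) (ξ : Ell2 S) (s : S) :
    permAlg Γ S f ξ s = ∑ g ∈ f.coeff.support, f.coeff g * ξ (g⁻¹ • s) := by
  rw [permAlg_eq_sum, sum_apply, lp.coeFn_sum, Finset.sum_apply]
  simp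

lemma permAlg_single (g : Γ) (c : ℂ) :
    permAlg Γ S (MonoidAlgebra.single g c) = c • permRep Γ S g := by
  simp [permAlg]

variable (Γ) in
/-- The involution `f*(g) = conj (f(g⁻¹))` on `ℂ[Γ]`. -/
def involution (f : MonoidAlgebra ℂ Γ) : MonoidAlgebra ℂ Γ :=
  ∑ g ∈ f.coeff.support, MonoidAlgebra.single g⁻¹ (star (f.coeff g))

lemma star_permAlg (f : MonoidAlgebra ℂ Γ) :
    star (permAlg Γ S f) = permAlg Γ S (involution Γ f) := by
  rw [permAlg_eq_sum, star_sum, involution, map_sum]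
  refine Finset.sum_congr rfl fun g _ => ?_
  rw [permAlg_single, star_smul, star_permRep]

end perm

section reduced

variable (Γ : Type u) [Group Γ]

/-- The image of `ℂ[Γ]` in `B(ℓ²(Γ))` under the left regular representation. -/
def regularImage : StarSubalgebra ℂ (Ell2 Γ →L[ℂ] Ell2 Γ) where
  toSubalgebra := (permAlg Γ Γ).range
  star_mem' := by
    rintro _ ⟨f, rfl⟩
    exact ⟨involution Γ f, (star_permAlg f).symm⟩

/-- The reduced group C*-algebra `C*_r(Γ)`: the norm closure of the image of `ℂ[Γ]` in
`B(ℓ²(Γ))` under the left regular representation. -/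
def ReducedCStar : StarSubalgebra ℂ (Ell2 Γ →L[ℂ] Ell2 Γ) :=
  (regularImage Γ).topologicalClosure

/-- The canonical map `ℂ[Γ] → C*_r(Γ)`. -/
def toReduced : MonoidAlgebra ℂ Γ →ₐ[ℂ] ReducedCStar Γ :=
  (permAlg Γ Γ).codRestrict (ReducedCStar Γ).toSubalgebra
    fun f => (regularImage Γ).le_topologicalClosure ⟨f, rfl⟩

variable {Γ}

@[simp] lemma coe_toReduced (f : MonoidAlgebra ℂ Γ) :
    ((toReduced Γ f : ReducedCStar Γ) : Ell2 Γ →L[ℂ] Ell2 Γ) = permAlg Γ Γ f := rfl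

lemma norm_toReduced (f : MonoidAlgebra ℂ Γ) : ‖toReduced Γ f‖ = ‖permAlg Γ Γ f‖ := rfl

variable (Γ) in
lemma denseRange_toReduced : DenseRange (toReduced Γ) := by
  rintro ⟨a, ha⟩
  rw [Metric.mem_closure_iff]
  intro ε hε
  have ha' : a ∈ closure ((regularImage Γ : Set (Ell2 Γ →L[ℂ] Ell2 Γ))) := ha
  obtain ⟨_, ⟨f, rfl⟩, hf⟩ := Metric.mem_closure_iff.1 ha' ε hε
  exact ⟨_, ⟨f, rfl⟩, hf⟩

lemma star_toReduced (f : MonoidAlgebra ℂ Γ) :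
    star (toReduced Γ f) = toReduced Γ (involution Γ f) :=
  Subtype.ext (star_permAlg f)

end reduced

section extension

variable {Γ : Type u} [Group Γ] {S : Type v} [MulAction Γ S]

/-- For a finite `F ⊆ Γ` and the set `F'` of its points `k` with `g⁻¹ k ∈ F` for all `g` in the
support of `f`, one has `|F'| ‖π(f)v‖² ≤ |F| ‖λ(f)‖² ‖v‖²`. -/
lemma card_mul_le [DecidableEq Γ] (f : MonoidAlgebra ℂ Γ) (v : Ell2 S) (F F' : Finset Γ)
    (hF : ∀ k ∈ F', ∀ g ∈ f.coeff.support, g⁻¹ * k ∈ F) :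
    (F'.card : ℝ) * ‖permAlg Γ S f v‖ ^ 2 ≤ F.card * (‖permAlg Γ Γ f‖ ^ 2 * ‖v‖ ^ 2) := by
  let ζ : S → Ell2 Γ := fun t => ∑ h ∈ F, lp.single 2 h (v (h • t))
  have hζ : ∀ t h, ζ t h = if h ∈ F then v (h • t) else 0 := by
    intro t h
    simp only [ζ]
    rw [lp.coeFn_sum, Finset.sum_apply]
    simp [lp.single_apply, Pi.single_apply]
  have hζn : ∀ t, ‖ζ t‖ ^ 2 = ∑ h ∈ F, ‖v (h • t)‖ ^ 2 := by
    intro t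
    rw [norm_sq_eq, tsum_eq_sum (s := F)]
    · exact Finset.sum_congr rfl fun h hh => by rw [hζ, if_pos hh]
    · intro h hh
      rw [hζ, if_neg hh]; simp
  have key : ∀ t, ∑ k ∈ F', ‖permAlg Γ S f v (k • t)‖ ^ 2 ≤
      ‖permAlg Γ Γ f‖ ^ 2 * ∑ h ∈ F, ‖v (h • t)‖ ^ 2 := by
    intro t
    have h1 : ∑ k ∈ F', ‖permAlg Γ S f v (k • t)‖ ^ 2 =
        ∑ k ∈ F', ‖permAlg Γ Γ f (ζ t) k‖ ^ 2 := by
      refine Finset.sum_congr rfl fun k hk => ?_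
      rw [permAlg_apply, permAlg_apply]
      congr 2
      refine Finset.sum_congr rfl fun g hg => ?_
      rw [hζ, smul_eq_mul, if_pos (hF k hk g hg), mul_smul]
    rw [h1, ← hζn, ← mul_pow]
    calc _ ≤ ∑' k, ‖permAlg Γ Γ f (ζ t) k‖ ^ 2 :=
          (summable_sq _).sum_le_tsum _ fun _ _ => by positivity
      _ = ‖permAlg Γ Γ f (ζ t)‖ ^ 2 := (norm_sq_eq _).symm
      _ ≤ _ := by gcongr; exact ContinuousLinearMap.le_opNorm _ _
  have hsum : ∀ (w : Ell2 S) (k : Γ), Summable fun t => ‖w (k • t)‖ ^ 2 := fun w k =>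
    (summable_sq w).comp_injective (MulAction.injective k)
  have htsum : ∀ (w : Ell2 S) (k : Γ), ∑' t, ‖w (k • t)‖ ^ 2 = ‖w‖ ^ 2 := fun w k => by
    rw [norm_sq_eq]
    exact (MulAction.toPerm k : Equiv.Perm S).tsum_eq (fun s => ‖w s‖ ^ 2)
  have hs := Summable.tsum_le_tsum key (summable_sum fun k _ => hsum _ k)
    ((summable_sum fun k _ => hsum _ k).mul_left _)
  rw [tsum_mul_left, Summable.tsum_finsetSum (fun k _ => hsum _ k),
    Summable.tsum_finsetSum (fun k _ => hsum _ k)] at hs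
  simp only [htsum, Finset.sum_const, nsmul_eq_mul] at hs
  linarith

/-- For amenable `Γ`, every permutation representation is weakly contained in the left regular
one. -/
lemma norm_permAlg_le [IsAmenable Γ] (f : MonoidAlgebra ℂ Γ) :
    ‖permAlg Γ S f‖ ≤ ‖toReduced Γ f‖ := by
  classical
  rw [norm_toReduced]
  refine ContinuousLinearMap.opNorm_le_bound _ (norm_nonneg _) fun v => ?_
  refine (sq_le_sq₀ (norm_nonneg _) (by positivity)).1 ?_
  rw [mul_pow]
  set A := ‖permAlg Γ S f v‖ ^ 2
  set B := ‖permAlg Γ Γ f‖ ^ 2 * ‖v‖ ^ 2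
  have hA : 0 ≤ A := by positivity
  set n : ℝ := (f.coeff.support.card : ℝ)
  have hmain : ∀ ε : ℝ, 0 < ε → A * (1 - n * ε) ≤ B := by
    intro ε hε
    obtain ⟨F, hne, hF⟩ := IsAmenable.exists_folner f.coeff.support ε hε
    let F' : Finset Γ := F.filter fun k => ∀ g ∈ f.coeff.support, g⁻¹ * k ∈ F
    have hcard := card_mul_le f v F F' fun k hk => (Finset.mem_filter.1 hk).2
    have hsub : F \ F' ⊆ f.coeff.support.biUnion fun g => F.filter fun k => g⁻¹ * k ∉ F := by
      intro k hk
      simp only [F', Finset.mem_sdiff, Finset.mem_filter, not_and, not_forall] at hk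
      obtain ⟨hk1, hk2⟩ := hk
      obtain ⟨g, hg, hgk⟩ := hk2 hk1
      exact Finset.mem_biUnion.2 ⟨g, hg, Finset.mem_filter.2 ⟨hk1, hgk⟩⟩
    have hone : ∀ g ∈ f.coeff.support,
        ((F.filter fun k => g⁻¹ * k ∉ F).card : ℝ) ≤ ε * F.card := by
      intro g hg
      refine le_trans ?_ (hF g hg)
      rw [← Set.ncard_coe_finset]
      refine Nat.cast_le.2 (Set.ncard_le_ncard ?_ ?_)
      · intro k hk
        simp only [Finset.coe_filter, Set.mem_ofPred_eq] at hk
        refine Or.inr ⟨hk.1, ?_⟩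
        rintro ⟨x, hx, rfl⟩
        exact hk.2 (by simpa using hx)
      · exact ((F.finite_toSet.image _).union F.finite_toSet).subset
          (symmDiff_le_sup (a := (fun x => g * x) '' (F : Set Γ)) (b := (F : Set Γ)))
    have h2 : ((F \ F').card : ℝ) ≤ n * (ε * F.card) := by
      calc ((F \ F').card : ℝ)
          ≤ ((f.coeff.support.biUnion fun g => F.filter fun k => g⁻¹ * k ∉ F).card : ℝ) := by
            exact_mod_cast Finset.card_le_card hsub
        _ ≤ ∑ g ∈ f.coeff.support, ((F.filter fun k => g⁻¹ * k ∉ F).card : ℝ) := by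
            exact_mod_cast Finset.card_biUnion_le
        _ ≤ ∑ _g ∈ f.coeff.support, ε * (F.card : ℝ) := Finset.sum_le_sum hone
        _ = _ := by simp [n]
    have h3 : ((F \ F').card : ℝ) + F'.card = F.card := by
      exact_mod_cast Finset.card_sdiff_add_card_eq_card (Finset.filter_subset _ F)
    have hpos : (0 : ℝ) < F.card := by exact_mod_cast hne.card_pos
    refine le_of_mul_le_mul_left (le_trans ?_ hcard) hpos
    calc (F.card : ℝ) * (A * (1 - n * ε)) = (F.card - n * (ε * F.card)) * A := by ring
      _ ≤ F'.card * A := by gcongr; linarith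
  by_contra! hlt
  have hn : 0 ≤ n := by positivity
  have hpos : 0 < A * n + 1 := by positivity
  have := hmain ((A - B) / 2 / (A * n + 1)) (by
    have : 0 < A - B := by linarith
    positivity)
  have h4 : A * (n * ((A - B) / 2 / (A * n + 1))) ≤ (A - B) / 2 := by
    have : A * (n * ((A - B) / 2 / (A * n + 1))) = (A - B) / 2 * (A * n / (A * n + 1)) := by
      field_simp
    rw [this]
    refine mul_le_of_le_one_right (by linarith) ?_
    rw [div_le_one hpos]; linarith
  linarith

variable (Γ S) in
/-- For amenable `Γ`, the unique continuous extension to `C*_r(Γ)` of the permutation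
representation of `ℂ[Γ]` on `ℓ²(S)`. -/
def permExt : ReducedCStar Γ →L[ℂ] (Ell2 S →L[ℂ] Ell2 S) :=
  (permAlg Γ S).toLinearMap.extendOfNorm (toReduced Γ).toLinearMap

@[simp] lemma permExt_toReduced [IsAmenable Γ] (f : MonoidAlgebra ℂ Γ) :
    permExt Γ S (toReduced Γ f) = permAlg Γ S f :=
  LinearMap.extendOfNorm_eq (f := (permAlg Γ S).toLinearMap) (e := (toReduced Γ).toLinearMap)
    (denseRange_toReduced Γ) ⟨1, fun f => by simpa using norm_permAlg_le f⟩ f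

variable (Γ S) in
/-- For amenable `Γ`, the *-representation of `C*_r(Γ)` on `ℓ²(S)` associated with the permutation
representation of `Γ`: the unique one that extends the representation of `ℂ[Γ]`. -/
def permStar [IsAmenable Γ] : ReducedCStar Γ →⋆ₐ[ℂ] (Ell2 S →L[ℂ] Ell2 S) where
  toFun := permExt Γ S
  map_one' := by
    have := permExt_toReduced (S := S) (1 : MonoidAlgebra ℂ Γ)
    simpa using this
  map_mul' a b := by
    refine (denseRange_toReduced Γ).induction_on₂ (p := fun a b =>
      permExt Γ S (a * b) = permExt Γ S a * permExt Γ S b) ?_ ?_ a b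
    · exact isClosed_eq (by fun_prop) (by fun_prop)
    · intro f g
      rw [← map_mul, permExt_toReduced, permExt_toReduced, permExt_toReduced, map_mul]
  map_zero' := map_zero _
  map_add' := map_add _
  commutes' c := by
    have := permExt_toReduced (S := S) (algebraMap ℂ (MonoidAlgebra ℂ Γ) c)
    rwa [AlgHom.commutes, AlgHom.commutes] at this
  map_star' a := by
    refine (denseRange_toReduced Γ).induction_on (p := fun a =>
      permExt Γ S (star a) = star (permExt Γ S a)) a ?_ ?_
    · exact isClosed_eq (by fun_prop) (by fun_prop)
    · intro f
      rw [star_toReduced, permExt_toReduced, permExt_toReduced, star_permAlg]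

lemma permStar_toReduced [IsAmenable Γ] (f : MonoidAlgebra ℂ Γ) :
    permStar Γ S (toReduced Γ f) = permAlg Γ S f :=
  permExt_toReduced f

end extension

section density

variable (Γ : Type u) [Group Γ] [IsAmenable Γ]

/-- The quasi-regular representation `λ_{Γ/X}` of `C*_r(Γ)` on `ℓ²(Γ/X)`, where `Γ/X` is the set
of left cosets: `λ_{Γ/X}(g) δ_{hX} = δ_{ghX}`. -/
def quasiRegular (X : Subgroup Γ) : ReducedCStar Γ →⋆ₐ[ℂ] (Ell2 (Γ ⧸ X) →L[ℂ] Ell2 (Γ ⧸ X)) :=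
  permStar Γ (Γ ⧸ X)

/-- The ideal `J_{Γ,𝒳} = ⋂_{X ∈ 𝒳} ker λ_{Γ/X}` of `C*_r(Γ)`. -/
def idealJ (𝒳 : Set (Subgroup Γ)) : Ideal (ReducedCStar Γ) :=
  ⨅ X ∈ 𝒳, RingHom.ker (quasiRegular Γ X)

/-- `𝒟_Γ`: the closed conjugation-invariant sets `𝒳` of subgroups for which `J_{Γ,𝒳} ∩ ℂ[Γ]` is
dense in `J_{Γ,𝒳}`. -/
def densitySets : Set (Set (Subgroup Γ)) :=
  {𝒳 | IsClosed 𝒳 ∧ ConjInvariant 𝒳 ∧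
    (idealJ Γ 𝒳 : Set (ReducedCStar Γ)) ⊆
      closure ((idealJ Γ 𝒳 : Set (ReducedCStar Γ)) ∩ Set.range (toReduced Γ))}

end density

/-- A discrete group has the Density Property if it is amenable and every closed
conjugation-invariant set of subgroups belongs to `𝒟_Γ`. -/
def DensityProperty (Γ : Type u) [Group Γ] : Prop :=
  ∃ _ : IsAmenable Γ, ∀ 𝒳 : Set (Subgroup Γ), IsClosed 𝒳 → ConjInvariant 𝒳 → 𝒳 ∈ densitySets Γ

end GroupDensity

end

/-!
Both cases rest on the amenability of `Γ`, in the form that every permutation representation of `Γ`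
is weakly contained in the regular one, and on the compactness of the space of subgroups.

*Abelian groups.* The closure of `J ∩ ℂ[Γ]` is a closed ideal of the commutative C⋆-algebra
`C*_r(Γ)`, so by Gelfand duality it suffices that a character `χ` killing `J ∩ ℂ[Γ]` kills `J`.
If `χ` were nontrivial on every `X ∈ 𝒳`, then by compactness there would be finitely many `x i` with
`χ (x i) ≠ 1` such that every `X ∈ 𝒳` contains one of them; then `∏ i, (x i - 1)` lies in
`J ∩ ℂ[Γ]` and `χ` does not vanish on it (`exists_trivial_of_character_eq_zero`). So `χ` is trivial
on some `X ∈ 𝒳`, and it comes from a character of the amenable group `Γ / X`. Such a character is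
weakly contained in the regular representation of `Γ / X`, so it vanishes on `ker λ_{Γ/X}`
(`character_le_quasiRegular`).

*Finite subgroups.* By compactness `𝒳` has only finitely many minimal elements. They are permuted by
conjugation, so by Dietzmann's lemma they generate a finite normal subgroup `N`
(`exists_finite_normal`). For a finite set `F` with `N F = F`, the function `φ g = |F ∩ gF| / |F|` is
finitely supported, positive definite and constant on the cosets of `N`. Multiplication of
coefficients by `φ` is a contraction of `C*_r(Γ)` with values in `ℂ[Γ]`, and it is close to the
identity at a given element if `F` is a suitable Følner set (`exists_multiplier_near`). It maps `J`
to itself: an element of `J` has coefficient sums zero over all right cosets of each minimal `X ∈ 𝒳`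
(`sum_coefficient_eq_zero`). This is preserved because `φ` is constant on these cosets, and for a
finitely supported element it implies membership in `J`, because every stabilizer of a point of
`Γ / Y` with `Y ∈ 𝒳` contains a minimal element of `𝒳` (`sum_mul_eq_zero`).
-/

open scoped ENNReal

noncomputable section

namespace GroupDensity

universe u v

/-! ### Amenability of abelian groups -/

/-- Elements `∏ s ∈ S, s ^ n s` with `0 ≤ n s < N`. -/
def exponentBox {G : Type u} [CommGroup G] [DecidableEq G] (S : Finset G) (N : ℕ) : Finset G :=
  (Fintype.piFinset fun _ : S => Finset.range N).image fun n => ∏ s : S, (s : G) ^ n s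

lemma card_exponentBox_le {G : Type u} [CommGroup G] [DecidableEq G] (S : Finset G) (N : ℕ) :
    (exponentBox S N).card ≤ N ^ S.card := by
  refine Finset.card_image_le.trans ?_
  simp

lemma exponentBox_mono {G : Type u} [CommGroup G] [DecidableEq G] (S : Finset G) (N : ℕ) :
    exponentBox S N ⊆ exponentBox S (N + 1) := by
  refine Finset.image_subset_image (Fintype.piFinset_subset _ _ fun _ => ?_)
  exact Finset.range_mono (Nat.le_succ N)

lemma one_mem_exponentBox {G : Type u} [CommGroup G] [DecidableEq G] (S : Finset G) (N : ℕ) :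
    1 ∈ exponentBox S (N + 1) :=
  Finset.mem_image.2 ⟨0, by simp, by simp⟩

lemma mul_mem_exponentBox {G : Type u} [CommGroup G] [DecidableEq G] {S : Finset G} {N : ℕ}
    {s x : G} (hs : s ∈ S) (hx : x ∈ exponentBox S N) : s * x ∈ exponentBox S (N + 1) := by
  obtain ⟨n, hn, rfl⟩ := Finset.mem_image.1 hx
  refine Finset.mem_image.2 ⟨n + Pi.single ⟨s, hs⟩ 1, ?_, ?_⟩
  · simp only [Fintype.mem_piFinset, Finset.mem_range] at hn ⊢
    intro a
    have := hn a
    by_cases h : a = ⟨s, hs⟩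
    · subst h; simpa using this
    · simp only [Pi.add_apply, Pi.single_eq_of_ne h]; omega
  · simp only [Pi.add_apply, pow_add, Finset.prod_mul_distrib]
    rw [mul_comm, Finset.prod_eq_single (⟨s, hs⟩ : S)]
    · simp
    · intro b _ hb; simp [Pi.single_eq_of_ne hb]
    · simp

/-- The boxes grow polynomially, so some step from `N` to `N + 1` enlarges the box by a factor of
at most `1 + ε`. -/
lemma exists_exponentBox_card_le {G : Type u} [CommGroup G] [DecidableEq G] (S : Finset G)
    {ε : ℝ} (hε : 0 < ε) :
    ∃ N, ((exponentBox S (N + 2)).card : ℝ) ≤ (1 + ε) * (exponentBox S (N + 1)).card := by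
  by_contra! h
  have hgrow : ∀ N, (1 + ε) ^ N ≤ ((exponentBox S (N + 1)).card : ℝ) := by
    intro N
    induction N with
    | zero =>
      have : 0 < (exponentBox S 1).card := Finset.card_pos.2 ⟨1, one_mem_exponentBox S 0⟩
      simpa using this
    | succ N ih =>
      rw [pow_succ, mul_comm]
      exact le_trans (by gcongr) (h N).le
  have ht := (tendsto_pow_const_div_const_pow_of_one_lt S.card
    (show (1 : ℝ) < 1 + ε by linarith)).comp (Filter.tendsto_add_atTop_nat 1)
  have hpos : (0 : ℝ) < 1 / (1 + ε) := by positivity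
  obtain ⟨N, hN⟩ := (ht.eventually (gt_mem_nhds hpos)).exists
  simp only [Function.comp_apply] at hN
  rw [div_lt_div_iff₀ (by positivity) (by positivity), one_mul, pow_succ,
    mul_lt_mul_iff_left₀ (by positivity)] at hN
  have := (hgrow N).trans (Nat.cast_le.2 (card_exponentBox_le S (N + 1)))
  rw [Nat.cast_pow] at this
  exact absurd hN (not_lt.2 this)

theorem isAmenable_of_commGroup (G : Type u) [CommGroup G] : IsAmenable G where
  exists_folner S ε hε := by
    classical
    obtain ⟨N, hN⟩ := exists_exponentBox_card_le S (half_pos hε)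
    refine ⟨exponentBox S (N + 1), ⟨1, one_mem_exponentBox S N⟩, fun g hg => ?_⟩
    set F := exponentBox S (N + 1)
    set B := exponentBox S (N + 2)
    have hFB : F ⊆ B := exponentBox_mono S (N + 1)
    have hgB : F.image (g * ·) ⊆ B := Finset.image_subset_iff.2 fun x hx => mul_mem_exponentBox hg hx
    have hcard : (F.image (g * ·)).card = F.card :=
      Finset.card_image_of_injective _ (mul_right_injective g)
    -- Both `F` and `gF` omit `|B| - |F|` elements of `B`.
    have hsub : symmDiff ((fun x => g * x) '' (F : Set G)) (F : Set G) ⊆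
        ((B \ F ∪ B \ F.image (g * ·) : Finset G) : Set G) := by
      rintro x (⟨hx, hx'⟩ | ⟨hx, hx'⟩)
      · rw [← Finset.coe_image] at hx
        simp only [Finset.coe_union, Finset.coe_sdiff]
        exact Or.inl ⟨hgB hx, hx'⟩
      · rw [← Finset.coe_image] at hx'
        simp only [Finset.coe_union, Finset.coe_sdiff]
        exact Or.inr ⟨hFB hx, hx'⟩
    have h1 := Set.ncard_le_ncard hsub (Finset.finite_toSet _)
    rw [Set.ncard_coe_finset] at h1
    have h2 := h1.trans (Finset.card_union_le _ _)
    have h3 := Finset.card_sdiff_add_card_eq_card hFB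
    have h4 := Finset.card_sdiff_add_card_eq_card hgB
    rw [hcard] at h4
    have h2' : ((symmDiff ((fun x => g * x) '' (F : Set G)) (F : Set G)).ncard : ℝ) ≤
        (B \ F).card + (B \ F.image (g * ·)).card := by exact_mod_cast h2
    have h3' : ((B \ F).card : ℝ) + F.card = B.card := by exact_mod_cast h3
    have h4' : ((B \ F.image (g * ·)).card : ℝ) + F.card = B.card := by exact_mod_cast h4
    linarith

/-! ### Compactness of the space of subgroups -/

lemma isOpen_setOf_mem {G : Type u} [Group G] (g : G) : IsOpen {X : Subgroup G | g ∈ X} := by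
  classical
  refine isOpen_induced_iff.2 ⟨{p | p g = true}, ?_, ?_⟩
  · have h : Continuous fun p : G → Bool => p g := continuous_apply g
    exact (isOpen_discrete {true}).preimage h
  · ext X; simp

lemma isOpen_setOf_le {G : Type u} [Group G] {X : Subgroup G} (hX : (X : Set G).Finite) :
    IsOpen {Y : Subgroup G | X ≤ Y} := by
  have : {Y : Subgroup G | X ≤ Y} = ⋂ g ∈ (X : Set G), {Y | g ∈ Y} := by
    ext Y; simp [SetLike.le_def]
  rw [this]
  exact hX.isOpen_biInter fun g _ => isOpen_setOf_mem g

instance compactSpace_subgroup (G : Type u) [Group G] : CompactSpace (Subgroup G) := by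
  classical
  let f : Subgroup G → G → Bool := fun X g => decide (g ∈ X)
  have hf : Topology.IsInducing f := ⟨by
    change TopologicalSpace.induced _ _ = TopologicalSpace.induced _ _
    congr!⟩
  have hrange : Set.range f = {p | p 1 = true} ∩ (⋂ a, ⋂ b, {p | p a = true → p b = true →
      p (a * b) = true}) ∩ ⋂ a, {p | p a = true → p a⁻¹ = true} := by
    ext p
    simp only [Set.mem_range, Set.mem_inter_iff, Set.mem_iInter, Set.mem_ofPred_eq]
    constructor
    · rintro ⟨X, rfl⟩
      simp only [f, decide_eq_true_eq]
      exact ⟨⟨X.one_mem, fun a b => X.mul_mem⟩, fun a => X.inv_mem⟩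
    · rintro ⟨⟨h1, h2⟩, h3⟩
      refine ⟨⟨⟨⟨{g | p g = true}, fun {a b} => h2 a b⟩, h1⟩, fun {a} => h3 a⟩, ?_⟩
      ext g
      simp [f, ← SetLike.mem_coe]
  have hcl : IsClosed (Set.range f) := by
    have h (a : G) : IsClopen {p : G → Bool | p a = true} :=
      (isClopen_discrete ({true} : Set Bool)).preimage (continuous_apply a)
    rw [hrange]
    refine ((h 1).1.inter (isClosed_iInter fun a => isClosed_iInter fun b => ?_)).inter
      (isClosed_iInter fun a => ?_)
    · exact isClosed_imp (h a).2 (isClosed_imp (h b).2 (h (a * b)).1)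
    · exact isClosed_imp (h a).2 (h a⁻¹).1
  refine ⟨?_⟩
  rw [hf.isCompact_iff, Set.image_univ]
  exact hcl.isCompact

/-! ### Finite conjugation-invariant sets of torsion elements -/

/-- Dietzmann's lemma for a generating set. The centre has finite index `n`, so it is finitely
generated. The transfer `g ↦ g ^ n` to the centre sends generators to torsion elements, so the group
is torsion; hence the centre is finite, and so is the group. -/
theorem finite_of_closure_eq_top {G : Type u} [Group G] {T : Set G} (hT : T.Finite)
    (hgen : Subgroup.closure T = ⊤) (hconj : ∀ g : G, ∀ t ∈ T, g * t * g⁻¹ ∈ T)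
    (htors : ∀ t ∈ T, IsOfFinOrder t) : Finite G := by
  have : Finite T := hT
  let c : G → T → T := fun g t => ⟨g * t * g⁻¹, hconj g t t.2⟩
  have hcenter : ∀ z : G, (∀ t ∈ T, z * t * z⁻¹ = t) → z ∈ Subgroup.center G := by
    intro z hz
    have : Subgroup.closure T ≤ Subgroup.centralizer {z} := by
      rw [Subgroup.closure_le]
      intro t ht
      rw [SetLike.mem_coe, Subgroup.mem_centralizer_singleton_iff]
      have := hz t ht
      rw [mul_inv_eq_iff_eq_mul] at this
      exact this.symm
    rw [hgen] at this
    refine Subgroup.mem_center_iff.2 fun g => ?_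
    exact Subgroup.mem_centralizer_singleton_iff.1 (this (Subgroup.mem_top g))
  have hfin : Finite (G ⧸ Subgroup.center G) := by
    refine Finite.of_injective (fun q : G ⧸ Subgroup.center G => c q.out) fun p q hpq => ?_
    rw [← p.out_eq, ← q.out_eq]
    refine QuotientGroup.eq.2 (hcenter _ fun t ht => ?_)
    have := congrArg Subtype.val (congrFun hpq ⟨t, ht⟩)
    simp only [c] at this
    calc (p.out⁻¹ * q.out) * t * (p.out⁻¹ * q.out)⁻¹
        = p.out⁻¹ * (q.out * t * q.out⁻¹) * p.out := by group
      _ = t := by rw [← this]; group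
  have : (Subgroup.center G).FiniteIndex := Subgroup.finiteIndex_of_finite_quotient
  have : Group.FG G := Group.fg_iff.2 ⟨T, hgen, hT⟩
  let _ : CommGroup (Subgroup.center G) :=
    { (inferInstance : Group (Subgroup.center G)) with
      mul_comm := fun a b => Subtype.ext (Subgroup.mem_center_iff.1 b.2 a) }
  have htorsion : ∀ g : G, IsOfFinOrder g := by
    have : Subgroup.closure T ≤ (CommGroup.torsion (Subgroup.center G)).comap
        (MonoidHom.transferCenterPow G) := by
      rw [Subgroup.closure_le]
      intro t ht
      exact (MonoidHom.transferCenterPow G).isOfFinOrder (htors t ht)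
    intro g
    have hg := this (hgen ▸ Subgroup.mem_top g)
    have hg' := (Subgroup.center G).subtype.isOfFinOrder ((CommGroup.mem_torsion _).1 hg)
    rw [Subgroup.subtype_apply, MonoidHom.transferCenterPow_apply, isOfFinOrder_pow] at hg'
    exact hg'.resolve_right Subgroup.FiniteIndex.index_ne_zero
  have : Finite (Subgroup.center G) := by
    refine CommGroup.finite_of_fg_isMulTorsion _ ?_
    intro z
    exact (Submonoid.isOfFinOrder_coe (H := (Subgroup.center G).toSubmonoid)).1 (htorsion z)
  exact Finite.of_subgroup_quotient (Subgroup.center G)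

theorem finite_closure_of_conj_mem {G : Type u} [Group G] {T : Set G} (hT : T.Finite)
    (hconj : ∀ g : G, ∀ t ∈ T, g * t * g⁻¹ ∈ T) (htors : ∀ t ∈ T, IsOfFinOrder t) :
    Finite (Subgroup.closure T) := by
  refine finite_of_closure_eq_top (T := ((↑) : Subgroup.closure T → G) ⁻¹' T)
    (hT.preimage Subtype.val_injective.injOn) Subgroup.closure_closure_coe_preimage
    (fun g t ht => hconj g t ht) fun t ht => ?_
  exact (Submonoid.isOfFinOrder_coe (H := (Subgroup.closure T).toSubmonoid)).1 (htors t ht)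

/-! ### The ideal `J` and its algebraic part -/

lemma isClosed_reducedCStar (Γ : Type u) [Group Γ] :
    IsClosed (ReducedCStar Γ : Set (Ell2 Γ →L[ℂ] Ell2 Γ)) :=
  (regularImage Γ).isClosed_topologicalClosure

instance completeSpace_reducedCStar (Γ : Type u) [Group Γ] : CompleteSpace (ReducedCStar Γ) :=
  (isClosed_reducedCStar Γ).completeSpace_coe

lemma permRep_norm_le {Γ : Type u} [Group Γ] {S : Type v} [MulAction Γ S] (g : Γ) :
    ‖permRep Γ S g‖ ≤ 1 :=
  (permIsometry S g).norm_toContinuousLinearMap_le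

lemma continuous_quasiRegular {Γ : Type u} [Group Γ] [IsAmenable Γ] (X : Subgroup Γ) :
    Continuous (quasiRegular Γ X) :=
  (permExt Γ (Γ ⧸ X)).continuous

lemma quasiRegular_toReduced {Γ : Type u} [Group Γ] [IsAmenable Γ] (X : Subgroup Γ)
    (f : MonoidAlgebra ℂ Γ) : quasiRegular Γ X (toReduced Γ f) = permAlg Γ (Γ ⧸ X) f :=
  permStar_toReduced f

lemma mem_idealJ {Γ : Type u} [Group Γ] [IsAmenable Γ] {𝒳 : Set (Subgroup Γ)}
    {a : ReducedCStar Γ} : a ∈ idealJ Γ 𝒳 ↔ ∀ X ∈ 𝒳, quasiRegular Γ X a = 0 := by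
  simp [idealJ, RingHom.mem_ker]

/-- The norm closure of `J_{Γ,𝒳} ∩ ℂ[Γ]`, as an ideal of `C*_r(Γ)`. -/
def algebraicClosure (Γ : Type u) [Group Γ] [IsAmenable Γ] (𝒳 : Set (Subgroup Γ)) :
    Ideal (ReducedCStar Γ) where
  carrier := closure ((idealJ Γ 𝒳 : Set (ReducedCStar Γ)) ∩ Set.range (toReduced Γ))
  zero_mem' := subset_closure ⟨zero_mem _, 0, map_zero _⟩
  add_mem' ha hb := map_mem_closure₂ continuous_add ha hb <| by
    rintro _ ⟨hx, f, rfl⟩ _ ⟨hy, g, rfl⟩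
    exact ⟨add_mem hx hy, f + g, map_add _ _ _⟩
  smul_mem' a b hb := map_mem_closure₂ continuous_mul (denseRange_toReduced Γ a) hb <| by
    rintro _ ⟨f, rfl⟩ _ ⟨hy, g, rfl⟩
    exact ⟨Ideal.mul_mem_left _ _ hy, f * g, map_mul _ _ _⟩

/-! ### Characters and regular representations of amenable groups -/

section twist

variable {G : Type u} [Group G]

/-- Multiplication on `ℓ²(S)` by a function with values of modulus one. -/
def mulIsometry {S : Type v} (w : S → ℂ) (hw : ∀ s, ‖w s‖ = 1) : Ell2 S →ₗᵢ[ℂ] Ell2 S where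
  toFun ξ := ⟨fun s => w s * ξ s, memℓp_gen (by
    simpa [hw] using (lp.memℓp ξ).summable (by norm_num))⟩
  map_add' ξ η := by ext s; exact mul_add _ _ _
  map_smul' c ξ := by ext s; exact mul_left_comm _ _ _
  norm_map' ξ := by
    refine (sq_eq_sq₀ (norm_nonneg _) (norm_nonneg _)).1 ?_
    rw [norm_sq_eq, norm_sq_eq]
    refine tsum_congr fun s => ?_
    change ‖w s * ξ s‖ ^ 2 = _
    rw [norm_mul, hw, one_mul]

@[simp] lemma mulIsometry_apply {S : Type v} (w : S → ℂ) (hw : ∀ s, ‖w s‖ = 1) (ξ : Ell2 S)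
    (s : S) : mulIsometry w hw ξ s = w s * ξ s := rfl

/-- The automorphism `δ_g ↦ χ(g) δ_g` of `ℂ[G]` for a homomorphism `χ`. -/
def twist (χ : G →* ℂ) : MonoidAlgebra ℂ G →ₐ[ℂ] MonoidAlgebra ℂ G :=
  MonoidAlgebra.lift ℂ _ G
    { toFun g := MonoidAlgebra.single g (χ g)
      map_one' := by rw [map_one]; rfl
      map_mul' g h := by rw [MonoidAlgebra.single_mul_single, map_mul] }

lemma twist_single (χ : G →* ℂ) (g : G) (c : ℂ) :
    twist χ (MonoidAlgebra.single g c) = MonoidAlgebra.single g (c * χ g) := by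
  simp [twist]

/-- Twisting by a unitary character is implemented by a unitary of `ℓ²(G)`. -/
lemma norm_permAlg_twist_le (χ : G →* ℂ) (hχ : ∀ g, ‖χ g‖ = 1) (f : MonoidAlgebra ℂ G) :
    ‖permAlg G G (twist χ f)‖ ≤ ‖permAlg G G f‖ := by
  let U := (mulIsometry χ hχ).toContinuousLinearMap
  let V := (mulIsometry (fun g => χ g⁻¹) fun g => hχ _).toContinuousLinearMap
  have hU : ‖U‖ ≤ 1 := LinearIsometry.norm_toContinuousLinearMap_le _
  have hV : ‖V‖ ≤ 1 := LinearIsometry.norm_toContinuousLinearMap_le _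
  have key : permAlg G G (twist χ f) = U * permAlg G G f * V := by
    induction f using MonoidAlgebra.induction_linear with
    | zero => simp
    | add f g hf hg => rw [map_add, map_add, map_add, hf, hg, mul_add, add_mul]
    | single g c =>
      rw [twist_single, permAlg_single, permAlg_single]
      ext ξ s
      change c * χ g * ξ (g⁻¹ * s) = χ s * (c * (χ (g⁻¹ * s)⁻¹ * ξ (g⁻¹ * s)))
      have : χ s * χ (g⁻¹ * s)⁻¹ = χ g := by rw [← map_mul]; congr 1; group
      rw [← this]; ring
  rw [key]
  calc ‖U * permAlg G G f * V‖ ≤ ‖U * permAlg G G f‖ * ‖V‖ := norm_mul_le _ _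
    _ ≤ ‖U‖ * ‖permAlg G G f‖ * ‖V‖ := by gcongr; exact norm_mul_le _ _
    _ ≤ 1 * ‖permAlg G G f‖ * 1 := by gcongr
    _ = ‖permAlg G G f‖ := by ring

/-- Unitary characters of an amenable group are weakly contained in the regular representation:
up to a twist, this is the case of the trivial representation on `ℓ²` of a point. -/
lemma norm_character_le [IsAmenable G] (ψ : MonoidAlgebra ℂ G →ₐ[ℂ] ℂ)
    (hψ : ∀ g, ‖ψ (MonoidAlgebra.single g 1)‖ = 1) (f : MonoidAlgebra ℂ G) :
    ‖ψ f‖ ≤ ‖permAlg G G f‖ := by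
  let χ : G →* ℂ := (ψ : MonoidAlgebra ℂ G →* ℂ).comp (MonoidAlgebra.of ℂ G)
  have hχ : ∀ g, χ g = ψ (MonoidAlgebra.single g 1) := fun _ => rfl
  have key : permAlg G PUnit.{1} (twist χ f) = algebraMap ℂ _ (ψ f) := by
    induction f using MonoidAlgebra.induction_linear with
    | zero => simp
    | add f g hf hg => rw [map_add, map_add, map_add, hf, hg, map_add]
    | single g c =>
      have h1 : permRep G PUnit.{1} g = 1 := by ext ξ s; rfl
      have h2 : (MonoidAlgebra.single g c : MonoidAlgebra ℂ G) =
          c • MonoidAlgebra.single g 1 := by simp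
      rw [twist_single, permAlg_single, h1, h2, map_smul, hχ, Algebra.algebraMap_eq_smul_one,
        smul_eq_mul]
  have : Nontrivial (Ell2 PUnit.{1}) :=
    ⟨lp.single 2 PUnit.unit (1 : ℂ), 0, fun h => by
      have := congrArg (fun ξ : Ell2 PUnit.{1} => ξ PUnit.unit) h
      simp at this⟩
  calc ‖ψ f‖ = ‖permAlg G PUnit.{1} (twist χ f)‖ := by rw [key, norm_algebraMap']
    _ ≤ ‖permAlg G G (twist χ f)‖ := norm_permAlg_le _
    _ ≤ _ := norm_permAlg_twist_le χ (fun g => by rw [hχ, hψ]) f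

end twist

/-! ### Abelian groups -/

/-- In a commutative C⋆-algebra, a closed ideal is the intersection of the kernels of the
characters that kill it. -/
theorem mem_of_forall_character {A : Type*} [CommCStarAlgebra A] {I : Ideal A}
    (hI : IsClosed (I : Set A)) {a : A}
    (h : ∀ χ : WeakDual.characterSpace ℂ A, (∀ b ∈ I, χ b = 0) → χ a = 0) : a ∈ I := by
  let e : A ≃⋆ₐ[ℂ] C(WeakDual.characterSpace ℂ A, ℂ) := gelfandStarTransform A
  have hiso : Isometry e.symm :=
    Isometry.right_inv (f := e) (gelfandTransform_isometry A) e.apply_symm_apply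
  let I' : Ideal C(WeakDual.characterSpace ℂ A, ℂ) := I.comap (e.symm : _ →⋆ₐ[ℂ] A)
  have hmem : ∀ b, e b ∈ I' ↔ b ∈ I := fun b => by
    simp [I', Ideal.mem_comap]
  have hI' : IsClosed (I' : Set C(WeakDual.characterSpace ℂ A, ℂ)) := hI.preimage hiso.continuous
  rw [← hmem, ← ContinuousMap.idealOfSet_ofIdeal_isClosed hI', ContinuousMap.mem_idealOfSet]
  intro χ hχ
  exact h χ fun b hb => ContinuousMap.notMem_setOfIdeal.1 hχ ((hmem b).2 hb)

section abelian

variable {Γ : Type u} [CommGroup Γ]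

/-- The C⋆-algebra structure of `C*_r(Γ)`, which is commutative since `Γ` is. -/
abbrev commCStarAlgebraReducedCStar : CommCStarAlgebra (ReducedCStar Γ) :=
  have := isClosed_reducedCStar Γ
  { (StarSubalgebra.cstarAlgebra (ReducedCStar Γ) : CStarAlgebra (ReducedCStar Γ)) with
    mul_comm a b := (denseRange_toReduced Γ).induction_on₂ (p := fun a b => a * b = b * a)
      (isClosed_eq (by fun_prop) (by fun_prop))
      (fun f g => by rw [← map_mul, ← map_mul, mul_comm]) a b }

/-- The action of `Γ` on `Γ / X` factors through the regular representation of `Γ / X`. -/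
lemma permAlg_quotient (X : Subgroup Γ) (f : MonoidAlgebra ℂ Γ) :
    permAlg Γ (Γ ⧸ X) f =
      permAlg (Γ ⧸ X) (Γ ⧸ X) (MonoidAlgebra.mapDomainAlgHom ℂ ℂ (QuotientGroup.mk' X) f) := by
  induction f using MonoidAlgebra.induction_linear with
  | zero => simp
  | add f g hf hg => rw [map_add, map_add, map_add, hf, hg]
  | single g c =>
    rw [MonoidAlgebra.mapDomainAlgHom_apply, MonoidAlgebra.mapDomain_single, permAlg_single,
      permAlg_single]
    rfl

lemma norm_character_single (χ : WeakDual.characterSpace ℂ (ReducedCStar Γ)) (g : Γ) :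
    ‖χ (toReduced Γ (MonoidAlgebra.single g 1))‖ = 1 := by
  have hle : ∀ h : Γ, ‖χ (toReduced Γ (MonoidAlgebra.single h 1))‖ ≤ 1 := fun h => by
    refine (AlgHom.norm_apply_le_self_mul_norm_one χ _).trans (mul_le_one₀ ?_ (norm_nonneg _)
      ContinuousLinearMap.norm_id_le)
    rw [norm_toReduced, permAlg_single, one_smul]
    exact permRep_norm_le h
  have h1 : χ (toReduced Γ (MonoidAlgebra.single g 1)) *
      χ (toReduced Γ (MonoidAlgebra.single g⁻¹ 1)) = 1 := by
    rw [← map_mul, ← map_mul, MonoidAlgebra.single_mul_single, mul_inv_cancel, one_mul,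
      ← MonoidAlgebra.one_def, map_one, map_one]
  have h2 := congrArg norm h1
  rw [norm_mul, norm_one] at h2
  refine le_antisymm (hle g) ?_
  rw [← h2]
  exact mul_le_of_le_one_right (norm_nonneg _) (hle g⁻¹)

variable [IsAmenable Γ]

/-- A character of `C*_r(Γ)` that is trivial on `X` factors through `λ_{Γ/X}`. -/
lemma character_le_quasiRegular (χ : WeakDual.characterSpace ℂ (ReducedCStar Γ)) (X : Subgroup Γ)
    (hX : ∀ x ∈ X, χ (toReduced Γ (MonoidAlgebra.single x 1)) = 1) (a : ReducedCStar Γ) :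
    ‖χ a‖ ≤ ‖quasiRegular Γ X a‖ := by
  refine (denseRange_toReduced Γ).induction_on (p := fun a => ‖χ a‖ ≤ ‖quasiRegular Γ X a‖) a
    (isClosed_le (map_continuous χ).norm (continuous_quasiRegular X).norm) fun f => ?_
  have : IsAmenable (Γ ⧸ X) := isAmenable_of_commGroup _
  let ρ : Γ →* ℂ := ((χ : ReducedCStar Γ →* ℂ).comp (toReduced Γ : MonoidAlgebra ℂ Γ →* _)).comp
    (MonoidAlgebra.of ℂ Γ)
  let ψ : MonoidAlgebra ℂ (Γ ⧸ X) →ₐ[ℂ] ℂ :=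
    MonoidAlgebra.lift ℂ ℂ (Γ ⧸ X) (QuotientGroup.lift X ρ hX)
  have hψ : ∀ g : Γ, ψ (MonoidAlgebra.single (g : Γ ⧸ X) 1) =
      χ (toReduced Γ (MonoidAlgebra.single g 1)) := fun g => by
    simp only [ψ, MonoidAlgebra.lift_single, one_smul]
    rfl
  have key : χ (toReduced Γ f) =
      ψ (MonoidAlgebra.mapDomainAlgHom ℂ ℂ (QuotientGroup.mk' X) f) := by
    induction f using MonoidAlgebra.induction_linear with
    | zero => simp
    | add f g hf hg => simp only [map_add, hf, hg]
    | single g c =>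
      have h2 : ∀ {G : Type u} [Group G] (g : G), (MonoidAlgebra.single g c : MonoidAlgebra ℂ G) =
          c • MonoidAlgebra.single g 1 := by simp
      rw [MonoidAlgebra.mapDomainAlgHom_apply, MonoidAlgebra.mapDomain_single, h2 g, h2, map_smul,
        map_smul, map_smul, QuotientGroup.mk'_apply, hψ]
  rw [quasiRegular_toReduced, permAlg_quotient, key]
  refine norm_character_le ψ (fun q => ?_) _
  obtain ⟨g, rfl⟩ := QuotientGroup.mk_surjective q
  rw [hψ, norm_character_single]

/-- If a character of `C*_r(Γ)` is nontrivial on each `X ∈ 𝒳`, then by compactness finitely many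
`x i` witness this, and `∏ i, (x i - 1)` is an element of `J_{Γ,𝒳} ∩ ℂ[Γ]` on which the character
does not vanish. -/
lemma exists_trivial_of_character_eq_zero {𝒳 : Set (Subgroup Γ)} (h𝒳 : IsClosed 𝒳)
    (χ : WeakDual.characterSpace ℂ (ReducedCStar Γ))
    (hχ : ∀ f : MonoidAlgebra ℂ Γ, toReduced Γ f ∈ idealJ Γ 𝒳 → χ (toReduced Γ f) = 0) :
    ∃ X ∈ 𝒳, ∀ x ∈ X, χ (toReduced Γ (MonoidAlgebra.single x 1)) = 1 := by
  classical
  by_contra! h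
  choose! x hx hχx using h
  obtain ⟨t, ht𝒳, ht⟩ := h𝒳.isCompact.elim_nhds_subcover (fun X => {Y | x X ∈ Y})
    fun X hX => (isOpen_setOf_mem (x X)).mem_nhds (hx X hX)
  let p : MonoidAlgebra ℂ Γ := ∏ X ∈ t, (MonoidAlgebra.single (x X) 1 - 1)
  have hp : toReduced Γ p ∈ idealJ Γ 𝒳 := by
    refine mem_idealJ.2 fun Y hY => ?_
    obtain ⟨X, hXt, hXY⟩ := Set.mem_iUnion₂.1 (ht hY)
    rw [quasiRegular_toReduced]
    have h0 : permAlg Γ (Γ ⧸ Y) (MonoidAlgebra.single (x X) 1 - 1) = 0 := by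
      rw [map_sub, permAlg_single, map_one, one_smul, sub_eq_zero]
      ext ξ s
      obtain ⟨g, rfl⟩ := QuotientGroup.mk_surjective s
      rw [permRep_apply]
      refine congrArg ξ ?_
      refine (QuotientGroup.eq (s := Y) (a := (x X)⁻¹ * g) (b := g)).2 ?_
      rwa [mul_inv_rev, inv_inv, mul_right_comm, inv_mul_cancel, one_mul]
    change permAlg Γ (Γ ⧸ Y) (∏ X ∈ t, (MonoidAlgebra.single (x X) 1 - 1)) = 0
    rw [← Finset.mul_prod_erase t _ hXt, map_mul, h0, zero_mul]
  have h0 := hχ p hp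
  let ρ : MonoidAlgebra ℂ Γ →ₐ[ℂ] ℂ := (WeakDual.CharacterSpace.toAlgHom χ).comp (toReduced Γ)
  change ρ p = 0 at h0
  rw [map_prod, Finset.prod_eq_zero_iff] at h0
  obtain ⟨X, hXt, h0⟩ := h0
  change χ (toReduced Γ _) = 0 at h0
  rw [map_sub, map_sub, map_one, map_one, sub_eq_zero] at h0
  exact hχx X (ht𝒳 X hXt) h0

theorem idealJ_subset_closure_of_commGroup {𝒳 : Set (Subgroup Γ)} (h𝒳 : IsClosed 𝒳) :
    (idealJ Γ 𝒳 : Set (ReducedCStar Γ)) ⊆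
      closure ((idealJ Γ 𝒳 : Set (ReducedCStar Γ)) ∩ Set.range (toReduced Γ)) := by
  intro a ha
  change a ∈ algebraicClosure Γ 𝒳
  let _ : CommCStarAlgebra (ReducedCStar Γ) := commCStarAlgebraReducedCStar
  refine mem_of_forall_character (I := algebraicClosure Γ 𝒳) isClosed_closure fun χ hχ => ?_
  obtain ⟨X, hX, hχX⟩ := exists_trivial_of_character_eq_zero h𝒳 χ fun f hf =>
    hχ _ (subset_closure ⟨hf, f, rfl⟩)
  have := character_le_quasiRegular χ X hχX a
  rw [mem_idealJ.1 ha X hX, norm_zero] at this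
  exact norm_le_zero_iff.1 this

end abelian

section comm

variable {Γ : Type u} [i : Group Γ]

theorem isAmenable_of_comm (hcomm : ∀ a b : Γ, a * b = b * a) : IsAmenable Γ :=
  @isAmenable_of_commGroup Γ { i with mul_comm := hcomm }

theorem idealJ_subset_closure_of_comm [IsAmenable Γ] (hcomm : ∀ a b : Γ, a * b = b * a)
    {𝒳 : Set (Subgroup Γ)} (h𝒳 : IsClosed 𝒳) :
    (idealJ Γ 𝒳 : Set (ReducedCStar Γ)) ⊆
      closure ((idealJ Γ 𝒳 : Set (ReducedCStar Γ)) ∩ Set.range (toReduced Γ)) :=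
  @idealJ_subset_closure_of_commGroup Γ { i with mul_comm := hcomm } ‹_› 𝒳 h𝒳

end comm

/-! ### Vectors of the form `ξ ⊗ 1_F` -/

/-- The vector `ξ ⊗ 1_F` of `ℓ²(S × T)`. -/
def tensorIndicator {S T : Type*} [DecidableEq T] (F : Finset T) (ξ : Ell2 S) : Ell2 (S × T) :=
  ⟨fun p => if p.2 ∈ F then ξ p.1 else 0, memℓp_gen <| by
    have h := (summable_sq ξ).mul_of_nonneg (g := fun t => if t ∈ F then (1 : ℝ) else 0)
      (summable_of_ne_finset_zero (s := F) fun t ht => if_neg ht)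
      (fun _ => by positivity) (fun t => by dsimp only; split_ifs <;> norm_num)
    refine h.congr fun p => ?_
    dsimp only
    split_ifs <;> simp⟩

lemma tensorIndicator_apply {S T : Type*} [DecidableEq T] (F : Finset T) (ξ : Ell2 S)
    (p : S × T) : tensorIndicator F ξ p = if p.2 ∈ F then ξ p.1 else 0 := rfl

lemma norm_sq_tensorIndicator {S T : Type*} [DecidableEq T] (F : Finset T) (ξ : Ell2 S) :
    ‖tensorIndicator F ξ‖ ^ 2 = F.card * ‖ξ‖ ^ 2 := by
  have hg : Summable fun t : T => if t ∈ F then (1 : ℝ) else 0 :=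
    summable_of_ne_finset_zero (s := F) fun t ht => if_neg ht
  have hF : ∑' t : T, (if t ∈ F then (1 : ℝ) else 0) = F.card := by
    rw [tsum_eq_sum (s := F) fun t ht => if_neg ht]
    simp
  have hnorm := tsum_mul_tsum_of_summable_norm (summable_sq ξ).norm hg.norm
  rw [norm_sq_eq, norm_sq_eq, mul_comm, ← hF, hnorm]
  refine tsum_congr fun p => ?_
  rw [tensorIndicator_apply]
  split_ifs <;> simp

lemma sum_slice_le {S T : Type*} (F : Finset T) (ζ : Ell2 (S × T)) :
    Summable (fun k => ∑ t ∈ F, ‖ζ (k, t)‖ ^ 2) ∧ ∑' k, ∑ t ∈ F, ‖ζ (k, t)‖ ^ 2 ≤ ‖ζ‖ ^ 2 := by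
  have h := summable_sq ζ
  have h1 : Summable (fun k => ∑ t ∈ F, ‖ζ (k, t)‖ ^ 2) := summable_sum fun t _ =>
    h.comp_injective fun _ _ hk => (Prod.ext_iff.1 hk).1
  refine ⟨h1, ?_⟩
  rw [norm_sq_eq, h.tsum_prod]
  exact h1.tsum_le_tsum (fun k => (h.prod_factor k).sum_le_tsum F fun _ _ => by positivity) h.prod

/-! ### Positive definite multipliers -/

section multiplier

variable {Γ : Type u} [Group Γ]

/-- The coefficient `a(g) = ⟨a δ_e, δ_g⟩` of an element `a` of `C*_r(Γ)`. -/
def coefficient (g : Γ) : ReducedCStar Γ →ₗ[ℂ] ℂ := by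
  classical
  exact
  { toFun a := (a : Ell2 Γ →L[ℂ] Ell2 Γ) (lp.single 2 1 (1 : ℂ)) g
    map_add' a b := rfl
    map_smul' c a := rfl }

lemma continuous_apply_ell2 {S : Type v} (s : S) : Continuous fun ξ : Ell2 S => ξ s :=
  (LipschitzWith.of_dist_le_mul (K := 1) fun ξ η => by
    rw [dist_eq_norm, dist_eq_norm, NNReal.coe_one, one_mul]
    exact lp.norm_apply_le_norm (by norm_num) (ξ - η) s).continuous

lemma continuous_coefficient (g : Γ) : Continuous (coefficient g) := by
  classical
  have h : Continuous fun a : ReducedCStar Γ => (a : Ell2 Γ →L[ℂ] Ell2 Γ) (lp.single 2 1 (1 : ℂ)) :=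
    continuous_subtype_val.clm_apply continuous_const
  exact (continuous_apply_ell2 g).comp h

lemma coefficient_toReduced (g : Γ) (f : MonoidAlgebra ℂ Γ) :
    coefficient g (toReduced Γ f) = f.coeff g := by
  classical
  change permAlg Γ Γ f (lp.single 2 1 (1 : ℂ)) g = _
  rw [permAlg_apply]
  simpa [lp.single_apply, Pi.single_apply, inv_mul_eq_one] using Eq.symm

/-- The function `g ↦ |F ∩ gF| / |F|`, which is positive definite and supported on `F F⁻¹`. -/
def overlap [DecidableEq Γ] (F : Finset Γ) (g : Γ) : ℝ :=
  ((F.filter fun t => g⁻¹ * t ∈ F).card : ℝ) / F.card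

/-- The product set `F F⁻¹`. -/
def differenceSet [DecidableEq Γ] (F : Finset Γ) : Finset Γ :=
  (F ×ˢ F).image fun p => p.1 * p.2⁻¹

lemma overlap_eq_zero [DecidableEq Γ] {F : Finset Γ} {g : Γ} (hg : g ∉ differenceSet F) :
    overlap F g = 0 := by
  rw [overlap, Finset.filter_eq_empty_iff.2, Finset.card_empty, Nat.cast_zero, zero_div]
  intro t ht h
  exact hg (Finset.mem_image.2 ⟨(t, g⁻¹ * t), Finset.mk_mem_product ht h, by simp⟩)

lemma overlap_le_one [DecidableEq Γ] (F : Finset Γ) (g : Γ) : overlap F g ≤ 1 :=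
  div_le_one_of_le₀ (Nat.cast_le.2 (Finset.card_filter_le _ _)) (Nat.cast_nonneg _)

/-- If `F` is invariant under left translation by `x`, then so is its overlap function. -/
lemma overlap_mul_left [DecidableEq Γ] {F : Finset Γ} {x : Γ} (hx : ∀ t, x * t ∈ F ↔ t ∈ F)
    (g : Γ) : overlap F (x * g) = overlap F g := by
  rw [overlap, overlap]
  congr 2
  refine Finset.card_bij (fun t _ => x⁻¹ * t) ?_ ?_ ?_
  · intro t ht
    rw [Finset.mem_filter] at ht ⊢
    refine ⟨(hx _).1 (by simpa using ht.1), by simpa [mul_assoc] using ht.2⟩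
  · intro a _ b _ h; exact mul_left_cancel h
  · intro t ht
    rw [Finset.mem_filter] at ht
    exact ⟨x * t, Finset.mem_filter.2 ⟨(hx t).2 ht.1, by simpa [mul_assoc] using ht.2⟩, by simp⟩

lemma one_sub_overlap_le [DecidableEq Γ] {F : Finset Γ} (hF : F.Nonempty) {g : Γ} {ε : ℝ}
    (h : ((symmDiff ((fun x => g * x) '' (F : Set Γ)) (F : Set Γ)).ncard : ℝ) ≤ ε * F.card) :
    1 - overlap F g ≤ ε := by
  have hpos : (0 : ℝ) < F.card := by exact_mod_cast hF.card_pos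
  have h1 : (F.filter fun t => g⁻¹ * t ∉ F).card ≤
      (symmDiff ((fun x => g * x) '' (F : Set Γ)) (F : Set Γ)).ncard := by
    rw [← Set.ncard_coe_finset]
    refine Set.ncard_le_ncard ?_ ?_
    · intro t ht
      rw [Finset.mem_coe, Finset.mem_filter] at ht
      refine Or.inr ⟨ht.1, ?_⟩
      rintro ⟨x, hx, rfl⟩
      exact ht.2 (by simpa using hx)
    · exact ((F.finite_toSet.image _).union F.finite_toSet).subset
        (symmDiff_le_sup (a := (fun x => g * x) '' (F : Set Γ)) (b := (F : Set Γ)))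
  have h2 := Finset.card_filter_add_card_filter_not (s := F) fun t => g⁻¹ * t ∈ F
  have h2' : ((F.filter fun t => g⁻¹ * t ∈ F).card : ℝ) +
      (F.filter fun t => g⁻¹ * t ∉ F).card = F.card := by exact_mod_cast h2
  have h1' : ((F.filter fun t => g⁻¹ * t ∉ F).card : ℝ) ≤ ε * F.card :=
    (Nat.cast_le.2 h1).trans h
  rw [overlap, sub_le_iff_le_add, ← sub_le_iff_le_add', le_div_iff₀ hpos]
  linarith

/-- The multiplier `f ↦ φ f` of `ℂ[Γ]`, for the overlap function `φ` of `F`, extended to a map from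
`C*_r(Γ)` to `ℂ[Γ]`. -/
def multiplier [DecidableEq Γ] (F : Finset Γ) : ReducedCStar Γ →ₗ[ℂ] MonoidAlgebra ℂ Γ where
  toFun a := ∑ g ∈ differenceSet F, MonoidAlgebra.single g (overlap F g * coefficient g a)
  map_add' a b := by
    simp only [map_add, mul_add, MonoidAlgebra.single_add, Finset.sum_add_distrib]
  map_smul' c a := by
    simp only [map_smul, smul_eq_mul, mul_left_comm, Finset.smul_sum, MonoidAlgebra.smul_single,
      RingHom.id_apply]

lemma permAlg_multiplier [DecidableEq Γ] {S : Type v} [MulAction Γ S] (F : Finset Γ)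
    (a : ReducedCStar Γ) : permAlg Γ S (multiplier F a) =
      ∑ g ∈ differenceSet F, (overlap F g * coefficient g a : ℂ) • permRep Γ S g := by
  simp only [multiplier, LinearMap.coe_mk, AddHom.coe_mk, map_sum, permAlg_single]

lemma continuous_multiplier [DecidableEq Γ] (F : Finset Γ) :
    Continuous fun a => toReduced Γ (multiplier F a) := by
  refine Continuous.subtype_mk (f := fun a => permAlg Γ Γ (multiplier F a)) ?_ _
  simp only [permAlg_multiplier]
  exact continuous_finsetSum _ fun g _ =>
    (continuous_const.mul (continuous_coefficient g)).smul continuous_const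

lemma permAlg_multiplier_toReduced [DecidableEq Γ] {S : Type v} [MulAction Γ S] (F : Finset Γ)
    (f : MonoidAlgebra ℂ Γ) : permAlg Γ S (multiplier F (toReduced Γ f)) =
      ∑ g ∈ f.coeff.support, (overlap F g * f.coeff g : ℂ) • permRep Γ S g := by
  rw [permAlg_multiplier]
  simp only [coefficient_toReduced]
  refine (Finset.sum_subset (Finset.inter_subset_left (s₂ := f.coeff.support)) ?_).symm.trans
    (Finset.sum_subset Finset.inter_subset_right ?_)
  · intro g h1 h2
    rw [Finsupp.notMem_support_iff.1 fun h => h2 (Finset.mem_inter.2 ⟨h1, h⟩)]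
    simp
  · intro g h1 h2
    rw [overlap_eq_zero fun h => h2 (Finset.mem_inter.2 ⟨h, h1⟩)]
    simp

/-- The multiplier of an overlap function is contractive: the compression of the diagonal action
on `ℓ²(Γ × Γ)` to `ℓ²(Γ) ⊗ 1_F` sends `f` to `|F| φ f`, and the diagonal action is weakly contained
in the regular representation. -/
lemma norm_permAlg_multiplier_toReduced_le [IsAmenable Γ] [DecidableEq Γ] {F : Finset Γ}
    (hF : F.Nonempty) (f : MonoidAlgebra ℂ Γ) :
    ‖permAlg Γ Γ (multiplier F (toReduced Γ f))‖ ≤ ‖toReduced Γ f‖ := by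
  have hpos : (0 : ℝ) < F.card := by exact_mod_cast hF.card_pos
  refine ContinuousLinearMap.opNorm_le_bound _ (norm_nonneg _) fun ξ => ?_
  set η := permAlg Γ Γ (multiplier F (toReduced Γ f)) ξ with hη
  set ζ := permAlg Γ (Γ × Γ) f (tensorIndicator F ξ) with hζ
  have hcomp : ∀ k, (F.card : ℂ) * η k = ∑ t ∈ F, ζ (k, t) := by
    intro k
    have h1 : η k = ∑ g ∈ f.coeff.support, (overlap F g * f.coeff g : ℂ) * ξ (g⁻¹ * k) := by
      rw [hη, permAlg_multiplier_toReduced, sum_apply, lp.coeFn_sum, Finset.sum_apply]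
      rfl
    have h2 : ∀ t, ζ (k, t) = ∑ g ∈ f.coeff.support,
        f.coeff g * if g⁻¹ * t ∈ F then ξ (g⁻¹ * k) else 0 := by
      intro t
      rw [hζ, permAlg_apply]
      rfl
    simp only [h1, h2]
    rw [Finset.sum_comm, Finset.mul_sum]
    refine Finset.sum_congr rfl fun g _ => ?_
    rw [← Finset.mul_sum, ← Finset.sum_filter, Finset.sum_const, nsmul_eq_mul, overlap]
    have : (F.card : ℂ) ≠ 0 := by exact_mod_cast hpos.ne'
    push_cast
    field_simp
  have hk : ∀ k, F.card * ‖η k‖ ^ 2 ≤ ∑ t ∈ F, ‖ζ (k, t)‖ ^ 2 := by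
    intro k
    have h1 : F.card * ‖η k‖ ≤ ∑ t ∈ F, ‖ζ (k, t)‖ := by
      have := norm_sum_le F fun t => ζ (k, t)
      rwa [← hcomp, norm_mul, Complex.norm_natCast] at this
    have h3 := sq_sum_le_card_mul_sum_sq (s := F) (f := fun t => ‖ζ (k, t)‖)
    have h4 : (F.card * ‖η k‖) ^ 2 ≤ F.card * ∑ t ∈ F, ‖ζ (k, t)‖ ^ 2 :=
      (pow_le_pow_left₀ (by positivity) h1 2).trans h3
    refine le_of_mul_le_mul_left (le_trans (le_of_eq ?_) h4) hpos
    ring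
  have hsum := Summable.tsum_le_tsum hk ((summable_sq η).mul_left _) (sum_slice_le F ζ).1
  rw [tsum_mul_left, ← norm_sq_eq] at hsum
  have hζn : ‖ζ‖ ≤ ‖toReduced Γ f‖ * ‖tensorIndicator F ξ‖ :=
    (ContinuousLinearMap.le_opNorm _ _).trans (by gcongr; exact norm_permAlg_le f)
  have h5 := hsum.trans ((sum_slice_le F ζ).2.trans (pow_le_pow_left₀ (norm_nonneg _) hζn 2))
  rw [mul_pow, norm_sq_tensorIndicator, mul_left_comm, mul_le_mul_iff_right₀ hpos, ← mul_pow] at h5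
  exact (sq_le_sq₀ (norm_nonneg _) (by positivity)).1 h5

lemma norm_multiplier_le [IsAmenable Γ] [DecidableEq Γ] {F : Finset Γ} (hF : F.Nonempty)
    (a : ReducedCStar Γ) :
    ‖toReduced Γ (multiplier F a)‖ ≤ ‖a‖ :=
  (denseRange_toReduced Γ).induction_on (p := fun a => ‖toReduced Γ (multiplier F a)‖ ≤ ‖a‖) a
    (isClosed_le (continuous_multiplier F).norm continuous_norm)
    (norm_permAlg_multiplier_toReduced_le hF)

lemma norm_multiplier_toReduced_sub_le [DecidableEq Γ] {F : Finset Γ}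
    (f : MonoidAlgebra ℂ Γ) {δ : ℝ} (hδ : ∀ g ∈ f.coeff.support, 1 - overlap F g ≤ δ) :
    ‖toReduced Γ (multiplier F (toReduced Γ f)) - toReduced Γ f‖ ≤
      δ * ∑ g ∈ f.coeff.support, ‖f.coeff g‖ := by
  rw [← map_sub, norm_toReduced, map_sub, permAlg_multiplier_toReduced, permAlg_eq_sum f,
    ← Finset.sum_sub_distrib, Finset.mul_sum]
  refine norm_sum_le_of_le _ fun g hg => ?_
  rw [← sub_smul, norm_smul]
  refine (mul_le_of_le_one_right (norm_nonneg _) (permRep_norm_le g)).trans ?_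
  have : (overlap F g * f.coeff g - f.coeff g : ℂ) = -(((1 - overlap F g : ℝ) : ℂ) * f.coeff g) := by
    push_cast; ring
  rw [this, norm_neg, norm_mul, Complex.norm_real, Real.norm_eq_abs,
    abs_of_nonneg (sub_nonneg.2 (overlap_le_one F g))]
  gcongr
  exact hδ g hg

/-- Følner sets can be chosen invariant under a given finite normal subgroup `N`: pass from a set
`F` to `N F`. -/
lemma exists_folner_invariant [IsAmenable Γ] {N : Subgroup Γ} [N.Normal] (hN : (N : Set Γ).Finite)
    [DecidableEq Γ]
    (S : Finset Γ) {ε : ℝ} (hε : 0 < ε) :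
    ∃ F : Finset Γ, F.Nonempty ∧ (∀ x ∈ N, ∀ t, x * t ∈ F ↔ t ∈ F) ∧
      ∀ g ∈ S, 1 - overlap F g ≤ ε := by
  set T := hN.toFinset with hT
  have hTmem : ∀ x, x ∈ T ↔ x ∈ N := fun x => hN.mem_toFinset
  have hTpos : (0 : ℝ) < T.card := by
    exact_mod_cast Finset.card_pos.2 ⟨1, (hTmem 1).2 N.one_mem⟩
  obtain ⟨F, ⟨t₀, ht₀⟩, hF⟩ := IsAmenable.exists_folner S (ε / T.card) (by positivity)
  set E : Finset Γ := (T ×ˢ F).image fun p => p.1 * p.2 with hE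
  have hEmem : ∀ s, s ∈ E ↔ ∃ x ∈ N, ∃ t ∈ F, x * t = s := by
    intro s
    simp only [hE, Finset.mem_image, Finset.mem_product, hTmem, Prod.exists]
    tauto
  have hFE : F ⊆ E := fun t ht => (hEmem t).2 ⟨1, N.one_mem, t, ht, one_mul t⟩
  refine ⟨E, ⟨t₀, hFE ht₀⟩, fun x hx t => ?_, fun g hg => one_sub_overlap_le ⟨t₀, hFE ht₀⟩ ?_⟩
  · rw [hEmem, hEmem]
    constructor
    · rintro ⟨y, hy, s, hs, h⟩
      exact ⟨x⁻¹ * y, N.mul_mem (N.inv_mem hx) hy, s, hs, by rw [mul_assoc, h]; group⟩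
    · rintro ⟨y, hy, s, hs, rfl⟩
      exact ⟨x * y, N.mul_mem hx hy, s, hs, mul_assoc _ _ _⟩
  · set D := symmDiff ((fun x => g * x) '' (F : Set Γ)) (F : Set Γ) with hD
    have hDfin : D.Finite := ((F.finite_toSet.image _).union F.finite_toSet).subset
        (symmDiff_le_sup (a := (fun x => g * x) '' (F : Set Γ)) (b := (F : Set Γ)))
    have hsub : symmDiff ((fun x => g * x) '' (E : Set Γ)) (E : Set Γ) ⊆
        (fun p : Γ × Γ => p.1 * p.2) '' ((N : Set Γ) ×ˢ D) := by
      rintro s (⟨⟨r, hr, rfl⟩, hs⟩ | ⟨hs, hs'⟩)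
      · obtain ⟨x, hx, t, ht, rfl⟩ := (hEmem r).1 hr
        have hx' : g * x * g⁻¹ ∈ N := ‹N.Normal›.conj_mem x hx g
        refine ⟨(g * x * g⁻¹, g * t), ⟨hx', Or.inl ⟨⟨t, ht, rfl⟩, fun h => hs ?_⟩⟩, by group⟩
        exact (hEmem _).2 ⟨_, hx', _, h, by group⟩
      · obtain ⟨x, hx, t, ht, rfl⟩ := (hEmem s).1 hs
        refine ⟨(x, t), ⟨hx, Or.inr ⟨ht, ?_⟩⟩, rfl⟩
        rintro ⟨r, hr, rfl⟩
        have hx' : g⁻¹ * x * g⁻¹⁻¹ ∈ N := ‹N.Normal›.conj_mem x hx g⁻¹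
        exact hs' ⟨g⁻¹ * x * g * r, (hEmem _).2 ⟨_, hx', r, hr, by group⟩, by group⟩
    have h1 := (Set.ncard_le_ncard hsub ((hN.prod hDfin).image _)).trans
      (Set.ncard_image_le (hN.prod hDfin))
    rw [Set.ncard_prod, Set.ncard_eq_toFinset_card _ hN] at h1
    have h2 : (D.ncard : ℝ) ≤ ε / T.card * F.card := hF g hg
    calc ((symmDiff ((fun x => g * x) '' (E : Set Γ)) (E : Set Γ)).ncard : ℝ)
        ≤ T.card * D.ncard := by exact_mod_cast h1
      _ ≤ T.card * (ε / T.card * F.card) := by gcongr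
      _ = ε * F.card := by field_simp
      _ ≤ ε * E.card := by gcongr

/-- Elements of `C*_r(Γ)` are approximated by multipliers invariant under a given finite normal
subgroup. -/
lemma exists_multiplier_near [IsAmenable Γ] {N : Subgroup Γ} [N.Normal] (hN : (N : Set Γ).Finite)
    [DecidableEq Γ]
    (a : ReducedCStar Γ) {ε : ℝ} (hε : 0 < ε) :
    ∃ F : Finset Γ, (∀ x ∈ N, ∀ t, x * t ∈ F ↔ t ∈ F) ∧
      dist a (toReduced Γ (multiplier F a)) < ε := by
  obtain ⟨_, ⟨f, rfl⟩, hf⟩ := Metric.mem_closure_iff.1 (denseRange_toReduced Γ a) (ε / 3)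
    (by positivity)
  rw [dist_eq_norm] at hf
  set c := ∑ g ∈ f.coeff.support, ‖f.coeff g‖
  have hc : 0 ≤ c := Finset.sum_nonneg fun _ _ => norm_nonneg _
  obtain ⟨F, hF, hinv, hover⟩ := exists_folner_invariant hN f.coeff.support
    (show 0 < ε / 3 / (c + 1) by positivity)
  refine ⟨F, hinv, ?_⟩
  have h1 := norm_multiplier_toReduced_sub_le f hover
  have h2 : ε / 3 / (c + 1) * c ≤ ε / 3 := by
    rw [div_mul_eq_mul_div]
    exact div_le_of_le_mul₀ (by positivity) (by positivity) (by nlinarith)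
  have h3 := norm_multiplier_le hF (a - toReduced Γ f)
  rw [dist_eq_norm]
  calc ‖a - toReduced Γ (multiplier F a)‖
      = ‖(a - toReduced Γ f) - (toReduced Γ (multiplier F (toReduced Γ f)) - toReduced Γ f) -
          toReduced Γ (multiplier F (a - toReduced Γ f))‖ := by
        congr 1; rw [map_sub, map_sub]; abel
    _ ≤ ‖a - toReduced Γ f‖ + ‖toReduced Γ (multiplier F (toReduced Γ f)) - toReduced Γ f‖ +
          ‖toReduced Γ (multiplier F (a - toReduced Γ f))‖ :=
        (norm_sub_le _ _).trans (by gcongr; exact norm_sub_le _ _)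
    _ < ε := by linarith

end multiplier

/-! ### Sets of finite subgroups -/

section finite

variable {Γ : Type u} [Group Γ]

/-- The coefficients of an element of `ker λ_{Γ/X}` have sum zero over each right coset of the
finite group `X`. -/
lemma sum_coefficient_eq_zero [IsAmenable Γ] {X : Subgroup Γ} [Fintype X] {a : ReducedCStar Γ}
    (ha : quasiRegular Γ X a = 0) (g : Γ) : ∑ x : X, coefficient (x * g) a = 0 := by
  classical
  have key : quasiRegular Γ X a (lp.single 2 ((g⁻¹ : Γ) : Γ ⧸ X) (1 : ℂ)) ((1 : Γ) : Γ ⧸ X) =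
      ∑ x : X, coefficient (x * g) a := by
    refine (denseRange_toReduced Γ).induction_on (p := fun a =>
      quasiRegular Γ X a (lp.single 2 ((g⁻¹ : Γ) : Γ ⧸ X) (1 : ℂ)) ((1 : Γ) : Γ ⧸ X) =
      ∑ x : X, coefficient (x * g) a) a (isClosed_eq ?_ ?_) fun f => ?_
    · exact (continuous_apply_ell2 _).comp
        ((ContinuousLinearMap.apply ℂ _ _).continuous.comp (continuous_quasiRegular X))
    · exact continuous_finsetSum _ fun x _ => continuous_coefficient _
    · rw [quasiRegular_toReduced, permAlg_apply]
      simp only [coefficient_toReduced]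
      have h1 : ∀ k : Γ, f.coeff k * (lp.single 2 ((g⁻¹ : Γ) : Γ ⧸ X) (1 : ℂ) : Ell2 (Γ ⧸ X))
          (k⁻¹ • ((1 : Γ) : Γ ⧸ X)) = if k * g⁻¹ ∈ X then f.coeff k else 0 := by
        intro k
        have : (k⁻¹ • ((1 : Γ) : Γ ⧸ X) = ((g⁻¹ : Γ) : Γ ⧸ X)) ↔ k * g⁻¹ ∈ X := by
          change (((k⁻¹ * 1 : Γ) : Γ ⧸ X) = _) ↔ _
          rw [QuotientGroup.eq, mul_one, inv_inv]
        rw [lp.single_apply, Pi.single_apply]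
        simp only [this, mul_ite, mul_one, mul_zero]
      simp only [h1]
      rw [← Finset.sum_filter]
      have h2 : ∑ x : X, f.coeff (x * g) = ∑ k ∈ Finset.univ.image fun x : X => (x : Γ) * g,
          f.coeff k := by
        rw [Finset.sum_image]
        intro x _ y _ h
        exact Subtype.ext (mul_right_cancel h)
      rw [h2]
      refine Finset.sum_subset_zero_on_sdiff ?_ ?_ fun _ _ => rfl
      · intro k hk
        exact Finset.mem_image.2 ⟨⟨k * g⁻¹, (Finset.mem_filter.1 hk).2⟩, Finset.mem_univ _, by simp⟩
      · intro k hk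
        obtain ⟨hk, hk'⟩ := Finset.mem_sdiff.1 hk
        obtain ⟨x, -, rfl⟩ := Finset.mem_image.1 hk
        refine Finsupp.notMem_support_iff.1 fun h => hk' (Finset.mem_filter.2 ⟨h, ?_⟩)
        simp
  rw [← key, ha]
  rfl

/-- A finitely supported function whose sums over the right cosets of a finite group `X` vanish acts
as zero on the part of `ℓ²(S)` over the fixed points of `X`. -/
lemma sum_mul_eq_zero {S : Type v} [MulAction Γ S] {X : Subgroup Γ} [Fintype X] {T : Finset Γ}
    {c : Γ → ℂ} (hT : ∀ g ∉ T, c g = 0) (hc : ∀ g, ∑ x : X, c (x * g) = 0) (ξ : S → ℂ) {s : S}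
    (hs : ∀ x ∈ X, x • s = s) : ∑ g ∈ T, c g * ξ (g⁻¹ • s) = 0 := by
  have hsum : Summable fun g => c g * ξ (g⁻¹ • s) :=
    summable_of_ne_finset_zero (s := T) fun g hg => by rw [hT g hg, zero_mul]
  rw [← tsum_eq_sum (L := SummationFilter.unconditional _) fun g hg => by rw [hT g hg, zero_mul]]
  have hshift : ∀ x : X, ∑' g, c (x * g) * ξ (g⁻¹ • s) = ∑' g, c g * ξ (g⁻¹ • s) := by
    intro x
    rw [← (Equiv.mulLeft (x : Γ)).tsum_eq fun g => c g * ξ (g⁻¹ • s)]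
    refine tsum_congr fun g => ?_
    rw [Equiv.coe_mulLeft, mul_inv_rev, mul_smul, hs _ (X.inv_mem x.2)]
  have hsum' : ∀ x : X, Summable fun g => c (x * g) * ξ (g⁻¹ • s) := by
    intro x
    refine ((Equiv.mulLeft (x : Γ)).summable_iff.2 hsum).congr fun g => ?_
    rw [Function.comp_apply, Equiv.coe_mulLeft, mul_inv_rev, mul_smul, hs _ (X.inv_mem x.2)]
  have h0 : ∑ x : X, ∑' g, c (x * g) * ξ (g⁻¹ • s) = 0 := by
    rw [← Summable.tsum_finsetSum fun x _ => hsum' x]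
    simp only [← Finset.sum_mul, hc, zero_mul, tsum_zero]
  simp only [hshift, Finset.sum_const, Finset.card_univ, nsmul_eq_mul, mul_eq_zero] at h0
  refine h0.resolve_left ?_
  exact_mod_cast Fintype.card_ne_zero

/-- A closed set of finite subgroups has only finitely many minimal elements, since the sets
`{Y | X ≤ Y}` with `X` minimal form an open cover. -/
lemma exists_finite_minimal {𝒳 : Set (Subgroup Γ)} (h𝒳 : IsClosed 𝒳)
    (hfin : ∀ X ∈ 𝒳, (X : Set Γ).Finite) :
    {X | Minimal (· ∈ 𝒳) X}.Finite ∧ ∀ Y ∈ 𝒳, ∃ X, Minimal (· ∈ 𝒳) X ∧ X ≤ Y := by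
  have hmin : ∀ Y ∈ 𝒳, ∃ X, Minimal (· ∈ 𝒳) X ∧ X ≤ Y := by
    intro Y hY
    have hY' : {X | X ∈ 𝒳 ∧ X ≤ Y}.Finite := by
      refine Set.Finite.of_finite_image (f := fun X : Subgroup Γ => (X : Set Γ))
        ((hfin Y hY).finite_subsets.subset ?_) SetLike.coe_injective.injOn
      rintro _ ⟨X, hX, rfl⟩
      exact hX.2
    obtain ⟨X, hXY, hX⟩ := hY'.exists_le_minimal ⟨hY, le_rfl⟩
    refine ⟨X, ⟨hX.1.1, fun Z hZ hZX => hX.2 ⟨hZ, hZX.trans hXY⟩ hZX⟩, hXY⟩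
  refine ⟨?_, hmin⟩
  obtain ⟨t, ht, hcover⟩ := h𝒳.isCompact.elim_finite_subcover_image
    (b := {X | Minimal (· ∈ 𝒳) X}) (c := fun X => {Y | X ≤ Y})
    (fun X hX => isOpen_setOf_le (hfin X hX.1)) (fun Y hY => by
      obtain ⟨X, hX, hXY⟩ := hmin Y hY
      exact Set.mem_iUnion₂.2 ⟨X, hX, hXY⟩)
  refine hcover.1.subset fun Y hY => ?_
  obtain ⟨X, hX, hXY⟩ := Set.mem_iUnion₂.1 (hcover.2 hY.1)
  rwa [← hY.eq_of_le (ht hX).1 hXY]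

lemma ConjInvariant.minimal {𝒳 : Set (Subgroup Γ)} (hconj : ConjInvariant 𝒳) {X : Subgroup Γ}
    (hX : Minimal (· ∈ 𝒳) X) (g : Γ) :
    Minimal (· ∈ 𝒳) (X.map (MulAut.conj g).toMonoidHom) := by
  refine ⟨hconj X hX.1 g, fun Z hZ hZX => ?_⟩
  have hback : ∀ (h : Γ) (W : Subgroup Γ), (W.map (MulAut.conj h).toMonoidHom).map
      (MulAut.conj h⁻¹).toMonoidHom = W := by
    intro h W
    ext w
    simp [Subgroup.mem_map, mul_assoc]
  have h1 := Subgroup.map_mono (f := (MulAut.conj g⁻¹).toMonoidHom) hZX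
  rw [hback] at h1
  have h2 := Subgroup.map_mono (f := (MulAut.conj g).toMonoidHom) (hX.2 (hconj Z hZ g⁻¹) h1)
  have h3 := hback g⁻¹ Z
  rw [inv_inv] at h3
  rwa [h3] at h2

/-- The minimal elements of a closed conjugation-invariant set of finite subgroups generate a finite
normal subgroup. -/
lemma exists_finite_normal {𝒳 : Set (Subgroup Γ)} (h𝒳 : IsClosed 𝒳) (hconj : ConjInvariant 𝒳)
    (hfin : ∀ X ∈ 𝒳, (X : Set Γ).Finite) :
    ∃ N : Subgroup Γ, N.Normal ∧ (N : Set Γ).Finite ∧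
      ∀ Y ∈ 𝒳, ∃ X ∈ 𝒳, X ≤ Y ∧ X ≤ N := by
  obtain ⟨hM, hmin⟩ := exists_finite_minimal h𝒳 hfin
  let T : Set Γ := ⋃ X ∈ {X | Minimal (· ∈ 𝒳) X}, (X : Set Γ)
  have hT : T.Finite := hM.biUnion fun X hX => hfin X hX.1
  have hTconj : ∀ g : Γ, ∀ t ∈ T, g * t * g⁻¹ ∈ T := by
    intro g t ht
    obtain ⟨X, hX, htX⟩ := Set.mem_iUnion₂.1 ht
    exact Set.mem_iUnion₂.2 ⟨_, hconj.minimal hX g, t, htX, rfl⟩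
  have htors : ∀ t ∈ T, IsOfFinOrder t := by
    intro t ht
    obtain ⟨X, hX, htX⟩ := Set.mem_iUnion₂.1 ht
    have : Finite X := hfin X hX.1
    exact (X.subtype).isOfFinOrder (isOfFinOrder_of_finite (⟨t, htX⟩ : X))
  refine ⟨Subgroup.closure T, ?_, finite_closure_of_conj_mem hT hTconj htors, fun Y hY => ?_⟩
  · refine ⟨fun x hx g => ?_⟩
    have hle : Subgroup.closure T ≤ (Subgroup.closure T).comap (MulAut.conj g).toMonoidHom :=
      (Subgroup.closure_le _).2 fun t ht => Subgroup.subset_closure (hTconj g t ht)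
    exact hle hx
  · obtain ⟨X, hX, hXY⟩ := hmin Y hY
    exact ⟨X, hX.1, hXY, fun x hx => Subgroup.subset_closure (Set.mem_iUnion₂.2 ⟨X, hX, hx⟩)⟩

theorem idealJ_subset_closure_of_finite [IsAmenable Γ] {𝒳 : Set (Subgroup Γ)} (h𝒳 : IsClosed 𝒳)
    (hconj : ConjInvariant 𝒳) (hfin : ∀ X ∈ 𝒳, (X : Set Γ).Finite) :
    (idealJ Γ 𝒳 : Set (ReducedCStar Γ)) ⊆
      closure ((idealJ Γ 𝒳 : Set (ReducedCStar Γ)) ∩ Set.range (toReduced Γ)) := by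
  classical
  intro a ha
  obtain ⟨N, hNnormal, hN, hXN⟩ := exists_finite_normal h𝒳 hconj hfin
  refine Metric.mem_closure_iff.2 fun ε hε => ?_
  obtain ⟨F, hinv, hF⟩ := exists_multiplier_near hN a hε
  refine ⟨_, ⟨?_, multiplier F a, rfl⟩, hF⟩
  refine mem_idealJ.2 fun Y hY => ?_
  rw [quasiRegular_toReduced, permAlg_multiplier]
  ext ξ s
  obtain ⟨h, rfl⟩ := QuotientGroup.mk_surjective s
  -- The stabilizer of `hY` is `hYh⁻¹`, which again belongs to `𝒳`.
  obtain ⟨X, hX, hXY, hXN⟩ := hXN _ (hconj Y hY h)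
  have : Finite X := hfin X hX
  let _ := Fintype.ofFinite X
  rw [sum_apply, lp.coeFn_sum, Finset.sum_apply]
  refine sum_mul_eq_zero (X := X) (c := fun g => (overlap F g * coefficient g a : ℂ))
    (fun g hg => ?_) (fun g => ?_) ξ fun x hx => ?_
  · simp [overlap_eq_zero hg]
  · simp only [fun x : X => overlap_mul_left (hinv x (hXN x.2)) g]
    rw [← Finset.mul_sum, sum_coefficient_eq_zero (mem_idealJ.1 ha X hX), mul_zero]
  · obtain ⟨y, hy, rfl⟩ := hXY hx
    refine (QuotientGroup.eq (s := Y) (a := h * y * h⁻¹ * h) (b := h)).2 ?_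
    have : (h * y * h⁻¹ * h)⁻¹ * h = y⁻¹ := by group
    rw [this]
    exact Y.inv_mem hy

end finite

end GroupDensity

end

theorem theorem3p12 :
    (∀ (Γ : Type*) [Group Γ] [GroupDensity.IsAmenable Γ] (𝒳 : Set (Subgroup Γ)),
      IsClosed 𝒳 → GroupDensity.ConjInvariant 𝒳 →
      ((Countable Γ ∧ ∀ a b : Γ, a * b = b * a) ∨ ∀ X ∈ 𝒳, (X : Set Γ).Finite) →
      𝒳 ∈ GroupDensity.densitySets Γ) ∧
    (∀ (Γ : Type*) [Group Γ] [Countable Γ], (∀ a b : Γ, a * b = b * a) →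
      GroupDensity.DensityProperty Γ) := by
  constructor
  · intro Γ _ _ 𝒳 h𝒳 hconj h
    refine ⟨h𝒳, hconj, ?_⟩
    rcases h with ⟨-, hcomm⟩ | hfin
    · exact GroupDensity.idealJ_subset_closure_of_comm hcomm h𝒳
    · exact GroupDensity.idealJ_subset_closure_of_finite h𝒳 hconj hfin
  · intro Γ _ _ hcomm
    have := GroupDensity.isAmenable_of_comm hcomm
    exact ⟨this, fun 𝒳 h𝒳 hconj =>
      ⟨h𝒳, hconj, GroupDensity.idealJ_subset_closure_of_comm hcomm h𝒳⟩⟩
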